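/- A permutation $\pi$ is a pattern of $\sigma$ if some subsequence of $\sigma$ has the same order type as $\pi$; $S_n(321)$ is the set of permutations of length $n$ that do not have $321$ as a pattern; a permutation $\mu$ is an $S_n(321)$-superpattern if every $\sigma\in S_n(321)$ is a pattern of $\mu$. The columns of a permutation $\sigma$ are its maximal ascending runs, numbered from left to right, and its rows are the sets of values that form the maximal ascending runs of $\sigma^{-1}$, numbered by increasing value. The chessboard representation of $\sigma$ is the matrix whose $(i,j)$ entry is the number of elements of $\sigma$ in row $i$ and column $j$. For $n\ge 0$ put $s=\lceil\sqrt n\,\rceil$ and $N=6n+8s$, and let $M_n$ be the $N\times N$ zero-one matrix with $[M_n]_{i,j}=1$ exactly when $0\le i-j\le 2s+1$, or $j-i=ks$ for some integer $k$ with $0\le k\le\lfloor N/s\rfloor$ (for $n=0$ the matrix is empty). **Theorem.** For every $n$ there is exactly one permutation $\mu_n$ whose chessboard representation is $M_n$. Both $\mu_n$ and its inverse $\mu_n^{-1}$ (the permutation obtained by exchanging the roles of rows and columns) are $S_n(321)$-superpatterns. The length of $\mu_n$ is $30n^{3/2}+\Theta(n)$, that is, there are constants $c,C>0$ and $n_0$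 such that $c\,n\le|\mu_n|-30n^{3/2}\le C\,n$ for all $n\ge n_0$. -/

import Mathlib

namespace Superpattern

open Equiv

/-- `π` is a pattern of `σ`: some subsequence of `σ` has the same order type as `π`.
The elements of `S_n` are the permutations of `Fin n` (positions and values numbered from `0`). -/
def IsPattern {k m : ℕ} (π : Perm (Fin k)) (σ : Perm (Fin m)) : Prop :=
  ∃ l : Fin k → Fin m, StrictMono l ∧ ∀ i j, π i < π j ↔ σ (l i) < σ (l j)

/-- The permutation `321`. -/
def perm321 : Perm (Fin 3) := Fin.revPerm

/-- `S_n(π)`: the permutations of length `n` that avoid `π`. -/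
def avoiders (n : ℕ) {k : ℕ} (π : Perm (Fin k)) : Set (Perm (Fin n)) :=
  {σ | ¬ IsPattern π σ}

/-- `μ` is a `P`-superpattern: every member of `P` is a pattern of `μ`. -/
def IsSuperpattern {m n : ℕ} (μ : Perm (Fin m)) (P : Set (Perm (Fin n))) : Prop :=
  ∀ σ ∈ P, IsPattern σ μ

/-- The index (from `0`, left to right) of the maximal ascending run of `σ` that contains the
position `p`: every descent at or before `p` starts a new run. -/
def runIndex {m : ℕ} (σ : Perm (Fin m)) (p : Fin m) : ℕ :=
  (Finset.univ.filter fun r : Fin m =>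
    r ≤ p ∧ ∃ q : Fin m, (q : ℕ) + 1 = (r : ℕ) ∧ σ r < σ q).card

/-- The number of maximal ascending runs of `σ`. -/
def numRuns {m : ℕ} (σ : Perm (Fin m)) : ℕ :=
  (Finset.univ.image (runIndex σ)).card

/-- `M` is the chessboard representation of `σ`. The columns of `σ` are its maximal ascending runs,
numbered from left to right; the rows are the sets of values that form the maximal ascending runs of
`σ⁻¹`, numbered by increasing value. `M i j` is the number of elements of `σ` in row `i` and
column `j`. -/
def IsChessboard {m r c : ℕ} (σ : Perm (Fin m)) (M : Matrix (Fin r) (Fin c) ℕ) : Prop :=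
  numRuns σ⁻¹ = r ∧ numRuns σ = c ∧
    ∀ i j, M i j = (Finset.univ.filter fun p : Fin m =>
      runIndex σ⁻¹ (σ p) = (i : ℕ) ∧ runIndex σ p = (j : ℕ)).card

/-- `⌈√n⌉`. -/
noncomputable def ceilSqrt (n : ℕ) : ℕ := ⌈Real.sqrt (n : ℝ)⌉₊

/-- The side length `6n + 8⌈√n⌉`. -/
noncomputable def side (n : ℕ) : ℕ := 6 * n + 8 * ceilSqrt n

open Classical in
/-- The zero-one matrix `M_n`: the band of entries at or below the diagonal at distance at most
`2⌈√n⌉ + 1` from it, and the diagonal lines (the diagonal itself and every `⌈√n⌉`-th one above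
it). -/
noncomputable def boardMatrix (n : ℕ) : Matrix (Fin (side n)) (Fin (side n)) ℕ := fun i j =>
  if (0 ≤ (i : ℤ) - (j : ℤ) ∧ (i : ℤ) - (j : ℤ) ≤ 2 * (ceilSqrt n : ℤ) + 1) ∨
      (∃ k : ℕ, k ≤ side n / ceilSqrt n ∧ (j : ℤ) - (i : ℤ) = (k : ℤ) * (ceilSqrt n : ℤ))
    then 1 else 0

end Superpattern

namespace Superpattern

open Equiv

/-! A 0-1 matrix determines its permutation: reading the ones by columns gives the positions, by
rows the values. Such a permutation exists once consecutive columns, and likewise rows, are forced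
to be separate runs by a descent (`exists_isChessboard`). Containing a pattern then amounts to
choosing ones in the right relative order (`IsChessboard.isPattern`).

A 321-avoider is a union of two increasing sequences: the left-to-right maxima (upper) and the rest
(lower). Write `A` and `B` for the largest value and the largest lower value up to a position, and
`L` for `lowBelow` of a value `v`; values count from 1, and 0 means none. The column is
`2(⌊A/s⌋+⌊B/s⌋)s + B mod s`, the row `(2(⌊v/s⌋+⌊L/s⌋)+ε)s + v mod s`, with `ε = 0` if `⌊v/s⌋ =
⌊L/s⌋` and `ε = 1` otherwise. An upper element has `v = A` and `L = B`, so row and column nearly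
agree and the cell is in the band (`cell_band`). A lower element has `v = B`, so row and column
agree modulo `s` and the cell is on a line (`cell_line`). The factor 2 leaves room for `ε` without
spoiling monotonicity. Inverses are covered because 321 is an involution.

For the length, with `s ≈ √n` and `N ≈ 6n`, the band contributes about `2sN ≈ 12n^(3/2)` and the
lines about `N²/(2s) ≈ 18n^(3/2)`. -/

theorem perm_inv_apply_self {α : Type*} (σ : Perm α) (x : α) : σ⁻¹ (σ x) = x :=
  σ.symm_apply_apply x

/-! ### Ascending runs and their indices. -/

section Runs

variable {m : ℕ} {σ : Perm (Fin m)}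

theorem runIndex_mono (σ : Perm (Fin m)) : Monotone (runIndex σ) := by
  intro p q hpq
  refine Finset.card_le_card fun r hr => ?_
  simp only [Finset.mem_filter, Finset.mem_univ, true_and] at hr ⊢
  exact ⟨hr.1.trans hpq, hr.2⟩

theorem runIndex_zero {p : Fin m} (hp : (p : ℕ) = 0) : runIndex σ p = 0 := by
  refine Finset.card_eq_zero.2 (Finset.filter_eq_empty_iff.2 ?_)
  rintro r - ⟨hr, q, hq, -⟩
  rw [Fin.le_def] at hr
  omega

theorem runIndex_step {q r : Fin m} (h : (q : ℕ) + 1 = r) :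
    runIndex σ r = runIndex σ q + if σ r < σ q then 1 else 0 := by
  unfold runIndex
  split_ifs with hd
  · rw [← Finset.card_insert_of_notMem (a := r)]
    · congr 1
      ext t
      simp only [Finset.mem_filter, Finset.mem_univ, true_and, Finset.mem_insert, Fin.le_def]
      constructor
      · rintro ⟨h1, h2⟩
        by_cases ht : t = r
        · exact Or.inl ht
        · refine Or.inr ⟨?_, h2⟩
          have : (t : ℕ) ≠ r := fun e => ht (Fin.ext e)
          omega
      · rintro (rfl | ⟨h1, h2⟩)
        · exact ⟨le_rfl, q, h, hd⟩
        · exact ⟨by omega, h2⟩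
    · simp only [Finset.mem_filter, Finset.mem_univ, true_and, Fin.le_def, not_and]
      intro h1
      omega
  · rw [add_zero]
    congr 1
    ext t
    simp only [Finset.mem_filter, Finset.mem_univ, true_and, Fin.le_def]
    constructor
    · rintro ⟨h1, q', h2, h3⟩
      refine ⟨?_, q', h2, h3⟩
      by_contra hlt
      have e1 : t = r := Fin.ext (by omega)
      have e2 : q' = q := Fin.ext (by rw [e1] at h2; omega)
      exact hd (by rw [← e1, ← e2]; exact h3)
    · rintro ⟨h1, h2⟩
      exact ⟨by omega, h2⟩

/-- A function that starts at `0` and increases by one exactly at the descents is the run index. -/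
theorem runIndex_eq_of_step (f : Fin m → ℕ) (h0 : ∀ p : Fin m, (p : ℕ) = 0 → f p = 0)
    (hs : ∀ q r : Fin m, (q : ℕ) + 1 = r → f r = f q + if σ r < σ q then 1 else 0) (p : Fin m) :
    runIndex σ p = f p := by
  obtain ⟨p, hp⟩ := p
  induction p with
  | zero => rw [runIndex_zero rfl, h0 _ rfl]
  | succ k ih =>
    rw [runIndex_step (q := ⟨k, by omega⟩) rfl, hs ⟨k, by omega⟩ _ rfl, ih]

theorem lt_of_runIndex_eq {p q : Fin m} (hpq : p < q) (h : runIndex σ p = runIndex σ q) :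
    σ p < σ q := by
  obtain ⟨q, hq⟩ := q
  induction q with
  | zero => exact absurd hpq (by simp [Fin.lt_def])
  | succ k ih =>
    have hk : k < m := by omega
    have hle : p ≤ ⟨k, hk⟩ := by
      rw [Fin.lt_def] at hpq
      rw [Fin.le_def]
      simp only at hpq ⊢
      omega
    have hstep := runIndex_step (σ := σ) (q := ⟨k, hk⟩) (r := ⟨k + 1, hq⟩) rfl
    have hmono := runIndex_mono σ hle
    have hasc : σ ⟨k, hk⟩ < σ ⟨k + 1, hq⟩ := by
      by_contra hn
      have hne : σ ⟨k + 1, hq⟩ ≠ σ ⟨k, hk⟩ := fun e => by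
        have := σ.injective e
        simp at this
      rw [if_pos (lt_of_le_of_ne (not_lt.1 hn) hne)] at hstep
      omega
    rcases hle.eq_or_lt with e | hlt
    · rwa [e]
    · refine (ih hk hlt ?_).trans hasc
      split_ifs at hstep <;> omega

theorem exists_runIndex_eq (p : Fin m) {k : ℕ} (hk : k ≤ runIndex σ p) :
    ∃ q, runIndex σ q = k := by
  obtain ⟨p, hp⟩ := p
  induction p with
  | zero =>
    rw [runIndex_zero rfl] at hk
    exact ⟨⟨0, hp⟩, by rw [runIndex_zero rfl]; omega⟩
  | succ t ih =>
    rcases hk.eq_or_lt with e | hlt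
    · exact ⟨_, e.symm⟩
    · refine ih (by omega) ?_
      rw [runIndex_step (q := ⟨t, by omega⟩) rfl] at hlt
      split_ifs at hlt <;> omega

theorem runIndex_lt_numRuns (p : Fin m) : runIndex σ p < numRuns σ := by
  have hsub : Finset.range (runIndex σ p + 1) ⊆ Finset.univ.image (runIndex σ) := by
    intro k hk
    obtain ⟨q, hq⟩ := exists_runIndex_eq p (Nat.lt_succ_iff.1 (Finset.mem_range.1 hk))
    exact Finset.mem_image.2 ⟨q, Finset.mem_univ _, hq⟩
  have := Finset.card_le_card hsub
  rw [Finset.card_range] at this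
  exact this

end Runs

/-! ### Patterns and uniqueness from chessboards. -/

section Chessboard

variable {k m r c : ℕ} {M : Matrix (Fin r) (Fin c) ℕ}

/-- A choice of nonzero cells in the right relative order gives an occurrence of a pattern. -/
theorem IsChessboard.isPattern {σ : Perm (Fin k)} {μ : Perm (Fin m)} (h : IsChessboard μ M)
    (row : Fin k → Fin r) (col : Fin k → Fin c) (hM : ∀ p, M (row p) (col p) ≠ 0)
    (hpos : ∀ p q, p < q → col p < col q ∨ col p = col q ∧ row p < row q)
    (hval : ∀ p q, σ p < σ q → row p < row q ∨ row p = row q ∧ col p < col q) :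
    IsPattern σ μ := by
  have hex : ∀ p, ∃ e : Fin m, runIndex μ⁻¹ (μ e) = row p ∧ runIndex μ e = col p := by
    intro p
    have h1 := hM p
    rw [h.2.2] at h1
    obtain ⟨e, he⟩ := Finset.card_ne_zero.1 h1
    exact ⟨e, (Finset.mem_filter.1 he).2⟩
  choose e her hec using hex
  have hcol : ∀ p q, col p < col q → e p < e q := by
    intro p q hlt
    by_contra hn
    have := runIndex_mono μ (not_lt.1 hn)
    rw [hec, hec] at this
    exact absurd hlt (not_lt.2 (Fin.le_def.2 this))
  have hrow : ∀ p q, row p < row q → μ (e p) < μ (e q) := by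
    intro p q hlt
    by_contra hn
    have := runIndex_mono μ⁻¹ (not_lt.1 hn)
    rw [her, her] at this
    exact absurd hlt (not_lt.2 (Fin.le_def.2 this))
  have hvalue : ∀ p q, σ p < σ q → μ (e p) < μ (e q) := by
    intro p q hlt
    rcases hval p q hlt with h1 | ⟨h1, h2⟩
    · exact hrow p q h1
    · have h3 := hcol p q h2
      by_contra hn
      rcases (not_lt.1 hn).eq_or_lt with h4 | h4
      · exact h3.ne' (μ.injective h4)
      -- A row is a run of `μ⁻¹`, so inside it larger values sit further right.
      · have := lt_of_runIndex_eq (σ := μ⁻¹) h4 (by rw [her, her, h1])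
        simp only [perm_inv_apply_self] at this
        exact absurd this h3.asymm
  refine ⟨e, fun p q hpq => ?_, fun p q => ⟨hvalue p q, fun hlt => ?_⟩⟩
  · rcases hpos p q hpq with h1 | ⟨h1, h2⟩
    · exact hcol p q h1
    · have h3 := hrow p q h2
      by_contra hn
      rcases (not_lt.1 hn).eq_or_lt with h4 | h4
      · exact h3.ne' (congrArg μ h4)
      · exact absurd (lt_of_runIndex_eq h4 (by rw [hec, hec, h1])) h3.asymm
  · by_contra hn
    rcases (not_lt.1 hn).eq_or_lt with h4 | h4
    · rw [σ.injective h4] at hlt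
      exact lt_irrefl _ hlt
    · exact absurd (hvalue q p h4) hlt.asymm

/-- The row of the chessboard that contains the element at position `p`. -/
def IsChessboard.row {μ : Perm (Fin m)} (h : IsChessboard μ M) (p : Fin m) : Fin r :=
  ⟨runIndex μ⁻¹ (μ p), h.1 ▸ runIndex_lt_numRuns _⟩

/-- The column of the chessboard that contains the element at position `p`. -/
def IsChessboard.col {μ : Perm (Fin m)} (h : IsChessboard μ M) (p : Fin m) : Fin c :=
  ⟨runIndex μ p, h.2.1 ▸ runIndex_lt_numRuns _⟩

theorem IsChessboard.apply_eq {μ : Perm (Fin m)} (h : IsChessboard μ M) (i : Fin r) (j : Fin c) :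
    M i j = (Finset.univ.filter fun p => (h.row p, h.col p) = (i, j)).card := by
  rw [h.2.2]
  simp only [IsChessboard.row, IsChessboard.col, Prod.mk.injEq, Fin.ext_iff]

theorem IsChessboard.length_eq {μ : Perm (Fin m)} (h : IsChessboard μ M) :
    m = ∑ i, ∑ j, M i j := by
  simp only [h.apply_eq]
  rw [← Fintype.sum_prod_type' (f := fun i j =>
    (Finset.univ.filter fun p => (h.row p, h.col p) = (i, j)).card), ← Finset.card_eq_sum_card_fiberwise (fun _ _ => Finset.mem_coe.2 (Finset.mem_univ _))]
  simp

/-- With at most one element per cell, the cells alone fix the relative order, so the cells of `σ`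
itself serve as the choice in `IsChessboard.isPattern`. -/
theorem IsChessboard.isPattern_of_le_one (hM : ∀ i j, M i j ≤ 1) {σ : Perm (Fin k)}
    {μ : Perm (Fin m)} (hσ : IsChessboard σ M) (hμ : IsChessboard μ M) : IsPattern σ μ := by
  have hinj : ∀ p q, hσ.row p = hσ.row q → hσ.col p = hσ.col q → p = q := by
    intro p q h1 h2
    have := hM (hσ.row q) (hσ.col q)
    rw [hσ.apply_eq, Finset.card_le_one] at this
    exact this p (by simp [h1, h2]) q (by simp)
  have hrow : ∀ p q, σ p < σ q → hσ.row p ≤ hσ.row q := fun p q h => runIndex_mono σ⁻¹ h.le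
  have hcol : ∀ p q, p < q → hσ.col p ≤ hσ.col q := fun p q h => runIndex_mono σ h.le
  refine hμ.isPattern hσ.row hσ.col (fun p => ?_) (fun p q hpq => ?_) (fun p q hpq => ?_)
  · rw [hσ.apply_eq]
    exact Finset.card_ne_zero.2 ⟨p, by simp⟩
  · rcases (hcol p q hpq).lt_or_eq with h1 | h1
    · exact Or.inl h1
    · refine Or.inr ⟨h1, ((hrow p q (lt_of_runIndex_eq hpq (Fin.ext_iff.1 h1))).lt_of_ne ?_)⟩
      exact fun h2 => hpq.ne (hinj p q h2 h1)
  · rcases (hrow p q hpq).lt_or_eq with h1 | h1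
    · exact Or.inl h1
    · have h3 := lt_of_runIndex_eq hpq (Fin.ext_iff.1 h1)
      simp only [perm_inv_apply_self] at h3
      refine Or.inr ⟨h1, (hcol p q h3).lt_of_ne fun h2 => h3.ne (hinj p q h1 h2)⟩

/-- The identity is the only strictly increasing self-map of `Fin m`; this applies first to the
embedding, then to `μ ∘ σ⁻¹`. -/
theorem IsPattern.eq {σ μ : Perm (Fin m)} (h : IsPattern σ μ) : σ = μ := by
  obtain ⟨l, hl, hσ⟩ := h
  have hid : l = id := by
    have := Subsingleton.elim (hl.orderIsoOfSurjective l
      (Finite.surjective_of_injective hl.injective)) (OrderIso.refl _)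
    funext x
    exact congrArg (fun f : Fin m ≃o Fin m => f x) this
  subst hid
  have hm : StrictMono (μ ∘ σ.symm) := by
    intro a b hab
    exact (hσ _ _).1 (by simpa using hab)
  have := Subsingleton.elim (hm.orderIsoOfSurjective _
      (Finite.surjective_of_injective hm.injective)) (OrderIso.refl _)
  ext x
  have h2 := congrArg (fun f : Fin m ≃o Fin m => f (σ x)) this
  simp at h2
  rw [h2]

theorem IsChessboard.unique (hM : ∀ i j, M i j ≤ 1) {μ ν : Σ m : ℕ, Perm (Fin m)}
    (hμ : IsChessboard μ.2 M) (hν : IsChessboard ν.2 M) : μ = ν := by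
  obtain ⟨a, μ⟩ := μ
  obtain ⟨b, ν⟩ := ν
  obtain rfl : a = b := hμ.length_eq.trans hν.length_eq.symm
  exact congrArg (Sigma.mk a) (hμ.isPattern_of_le_one hM hν).eq

end Chessboard

/-! ### Building a permutation from a matrix. -/

section Existence

theorem exists_enumeration {α β : Type*} [Fintype α] [LinearOrder β] (key : α → β)
    (hkey : Function.Injective key) :
    ∃ e : Fin (Fintype.card α) ≃ α, ∀ p q, p < q ↔ key (e p) < key (e q) := by
  let _ := LinearOrder.lift' key hkey
  exact ⟨(Fintype.orderIsoFinOfCardEq α rfl).toEquiv,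
    fun p q => ((Fintype.orderIsoFinOfCardEq α rfl).lt_iff_lt (x := p) (y := q)).symm⟩

/-- Columns ascend internally, so descents can occur only between columns. One does occur at each
boundary: the last element of a column is at least as high as any witness there, and the first of
the next column at least as low. -/
theorem runIndex_eq_col {m r c : ℕ} {σ : Perm (Fin m)} (row : Fin m → Fin r) (col : Fin m → Fin c)
    (hpos : ∀ p q, p < q ↔ col p < col q ∨ col p = col q ∧ row p < row q)
    (hval : ∀ p q, σ p < σ q ↔ row p < row q ∨ row p = row q ∧ col p < col q)
    (hcol : ∀ j, ∃ p, col p = j)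
    (hdesc : ∀ j j' : Fin c, (j : ℕ) + 1 = j' → ∃ p q, col p = j ∧ col q = j' ∧ row q < row p)
    (p : Fin m) : runIndex σ p = col p := by
  have hmono : ∀ p q, p ≤ q → col p ≤ col q := by
    intro p q hpq
    rcases hpq.eq_or_lt with rfl | h
    · exact le_rfl
    · rcases (hpos p q).1 h with h | h
      · exact h.le
      · exact h.1.le
  refine runIndex_eq_of_step (fun p => (col p : ℕ)) (fun p hp => ?_) (fun q r hqr => ?_) p
  · obtain ⟨p', hp'⟩ := hcol ⟨0, (Nat.zero_le _).trans_lt (col p).2⟩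
    have := Fin.le_def.1 (hmono p p' (Fin.le_def.2 (by omega)))
    rw [hp'] at this
    exact Nat.le_zero.1 this
  · have hlt : q < r := Fin.lt_def.2 (by omega)
    have hbetween : ∀ t, t ≤ q ∨ r ≤ t := by
      intro t
      simp only [Fin.le_def]
      omega
    rcases (hpos q r).1 hlt with h | ⟨h1, h2⟩
    · have hlt' := Fin.lt_def.1 h
      have hj : (col q : ℕ) + 1 = col r := by
        obtain ⟨t, ht⟩ := hcol ⟨col q + 1, by have := (col r).2; omega⟩
        have ht' := Fin.ext_iff.1 ht
        simp only at ht'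
        rcases hbetween t with h3 | h3
        · have := Fin.le_def.1 (hmono _ _ h3)
          omega
        · have := Fin.le_def.1 (hmono _ _ h3)
          omega
      obtain ⟨a, b, ha, hb, hab⟩ := hdesc _ _ hj
      have haq : row a ≤ row q := by
        have : a ≤ q := (hbetween a).resolve_right fun h3 => by
          have := hmono _ _ h3
          rw [ha] at this
          exact absurd h (not_lt.2 this)
        rcases this.eq_or_lt with rfl | h3
        · exact le_rfl
        · rcases (hpos _ _).1 h3 with h4 | h4
          · exact absurd ha h4.ne
          · exact h4.2.le
      have hrb : row r ≤ row b := by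
        have : r ≤ b := (hbetween b).resolve_left fun h3 => by
          have := hmono _ _ h3
          rw [hb] at this
          exact absurd h (not_lt.2 this)
        rcases this.eq_or_lt with rfl | h3
        · exact le_rfl
        · rcases (hpos _ _).1 h3 with h4 | h4
          · exact absurd hb h4.ne'
          · exact h4.2.le
      rw [if_pos ((hval r q).2 (Or.inl (hrb.trans_lt (hab.trans_le haq))))]
      exact hj.symm
    · rw [if_neg ((hval q r).2 (Or.inl h2)).asymm, h1, add_zero]

theorem numRuns_eq_of_runIndex_eq {m c : ℕ} {σ : Perm (Fin m)} (col : Fin m → Fin c)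
    (hcol : ∀ j, ∃ p, col p = j) (h : ∀ p, runIndex σ p = col p) : numRuns σ = c := by
  have : Finset.univ.image (runIndex σ) = Finset.range c := by
    ext k
    simp only [Finset.mem_image, Finset.mem_univ, true_and, Finset.mem_range]
    constructor
    · rintro ⟨p, rfl⟩
      rw [h]
      exact (col p).2
    · intro hk
      obtain ⟨p, hp⟩ := hcol ⟨k, hk⟩
      exact ⟨p, by rw [h, hp]⟩
  rw [numRuns, this, Finset.card_range]

/-- A zero-one matrix without zero rows or columns is a chessboard representation if, for any two
consecutive columns, some entry of the second lies strictly above some entry of the first, and the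
same holds for rows. -/
theorem exists_isChessboard {r c : ℕ} (M : Matrix (Fin r) (Fin c) ℕ) (hM : ∀ i j, M i j ≤ 1)
    (hcol : ∀ j, ∃ i, M i j = 1) (hrow : ∀ i, ∃ j, M i j = 1)
    (hcol' : ∀ j j' : Fin c, (j : ℕ) + 1 = j' → ∃ i i', M i j = 1 ∧ M i' j' = 1 ∧ i' < i)
    (hrow' : ∀ i i' : Fin r, (i : ℕ) + 1 = i' → ∃ j j', M i j = 1 ∧ M i' j' = 1 ∧ j' < j) :
    ∃ (m : ℕ) (σ : Perm (Fin m)), IsChessboard σ M := by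
  let α := {x : Fin r × Fin c // M x.1 x.2 = 1}
  obtain ⟨e₁, h₁⟩ := exists_enumeration (fun x : α => toLex (x.1.2, x.1.1)) (by
    intro x y h
    have := toLex.injective h
    simp only [Prod.mk.injEq] at this
    exact Subtype.ext (Prod.ext this.2 this.1))
  obtain ⟨e₂, h₂⟩ := exists_enumeration (fun x : α => toLex (x.1.1, x.1.2)) (by
    intro x y h
    have := toLex.injective h
    simp only [Prod.mk.injEq] at this
    exact Subtype.ext (Prod.ext this.1 this.2))
  let σ : Perm (Fin (Fintype.card α)) := e₁.trans e₂.symm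
  let row : Fin (Fintype.card α) → Fin r := fun p => (e₁ p).1.1
  let col : Fin (Fintype.card α) → Fin c := fun p => (e₁ p).1.2
  have hcell : ∀ i j, M i j = 1 → ∃ p, row p = i ∧ col p = j := by
    intro i j h
    refine ⟨e₁.symm ⟨(i, j), h⟩, ?_, ?_⟩ <;> simp [row, col]
  have hpos : ∀ p q, p < q ↔ col p < col q ∨ col p = col q ∧ row p < row q := by
    intro p q
    rw [h₁, Prod.Lex.toLex_lt_toLex]
  have hval : ∀ p q, σ p < σ q ↔ row p < row q ∨ row p = row q ∧ col p < col q := by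
    intro p q
    rw [h₂, Prod.Lex.toLex_lt_toLex]
    simp [σ, row, col]
  have hsurj : ∀ j, ∃ p, col p = j := fun j => by
    obtain ⟨i, hi⟩ := hcol j
    obtain ⟨p, -, hp⟩ := hcell i j hi
    exact ⟨p, hp⟩
  have hsurj' : ∀ i, ∃ p, row (σ⁻¹ p) = i := fun i => by
    obtain ⟨j, hj⟩ := hrow i
    obtain ⟨p, hp, -⟩ := hcell i j hj
    exact ⟨σ p, by simpa using hp⟩
  have hc : ∀ p, runIndex σ p = col p := by
    refine runIndex_eq_col row col hpos hval hsurj fun j j' hj => ?_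
    obtain ⟨i, i', h1, h2, h3⟩ := hcol' j j' hj
    obtain ⟨p, hp, hp'⟩ := hcell _ _ h1
    obtain ⟨q, hq, hq'⟩ := hcell _ _ h2
    exact ⟨p, q, hp', hq', by rwa [hp, hq]⟩
  have hr : ∀ p, runIndex σ⁻¹ p = row (σ⁻¹ p) := by
    -- The same lemma for `σ⁻¹`, with rows and columns exchanged.
    refine runIndex_eq_col (fun p => col (σ⁻¹ p)) (fun p => row (σ⁻¹ p)) (fun p q => ?_)
      (fun p q => hpos _ _) hsurj' fun i i' hi => ?_
    · rw [← hval]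
      simp
    · obtain ⟨j, j', h1, h2, h3⟩ := hrow' i i' hi
      obtain ⟨p, hp, hp'⟩ := hcell _ _ h1
      obtain ⟨q, hq, hq'⟩ := hcell _ _ h2
      refine ⟨σ p, σ q, ?_, ?_, ?_⟩
      · simpa using hp
      · simpa using hq
      · simp only [perm_inv_apply_self]
        rwa [hp', hq']
  refine ⟨_, σ, numRuns_eq_of_runIndex_eq _ hsurj' hr, numRuns_eq_of_runIndex_eq _ hsurj hc,
    fun i j => ?_⟩
  have hset : ∀ p, (runIndex σ⁻¹ (σ p) = (i : ℕ) ∧ runIndex σ p = (j : ℕ)) ↔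
      row p = i ∧ col p = j := by
    intro p
    rw [hr, hc, perm_inv_apply_self, Fin.ext_iff, Fin.ext_iff]
  simp only [hset]
  rcases Nat.le_one_iff_eq_zero_or_eq_one.1 (hM i j) with h | h
  · rw [h, eq_comm, Finset.card_eq_zero, Finset.filter_eq_empty_iff]
    rintro p - ⟨hp, hp'⟩
    have := (e₁ p).2
    change M (row p) (col p) = 1 at this
    rw [hp, hp', h] at this
    exact zero_ne_one this
  · rw [h, eq_comm, Finset.card_eq_one]
    obtain ⟨p, hp, hp'⟩ := hcell i j h
    refine ⟨p, ?_⟩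
    ext q
    simp only [Finset.mem_filter, Finset.mem_univ, true_and, Finset.mem_singleton]
    constructor
    · rintro ⟨hq, hq'⟩
      exact e₁.injective (Subtype.ext (Prod.ext (hq.trans hp.symm) (hq'.trans hp'.symm)))
    · rintro rfl
      exact ⟨hp, hp'⟩

end Existence

/-! ### The matrix is a chessboard representation. -/

section Board

theorem ceilSqrt_pos {n : ℕ} (hn : 0 < n) : 0 < ceilSqrt n :=
  Nat.ceil_pos.2 (Real.sqrt_pos.2 (Nat.cast_pos.2 hn))

theorem pos_of_fin_side {n : ℕ} (i : Fin (side n)) : 0 < n := by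
  rcases Nat.eq_zero_or_pos n with rfl | h
  · have := i.2
    simp [side, ceilSqrt] at this
  · exact h

theorem boardMatrix_le_one {n : ℕ} (i j : Fin (side n)) : boardMatrix n i j ≤ 1 := by
  unfold boardMatrix
  split_ifs <;> omega

theorem boardMatrix_band {n : ℕ} {i j : Fin (side n)} (h1 : (j : ℕ) ≤ i)
    (h2 : (i : ℕ) ≤ j + (2 * ceilSqrt n + 1)) : boardMatrix n i j = 1 :=
  if_pos (Or.inl ⟨by omega, by omega⟩)

theorem boardMatrix_line {n : ℕ} {i j : Fin (side n)} (k : ℕ) (h : (j : ℕ) = i + k * ceilSqrt n) :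
    boardMatrix n i j = 1 := by
  refine if_pos (Or.inr ⟨k, ?_, by rw [h]; push_cast; ring⟩)
  rw [Nat.le_div_iff_mul_le (ceilSqrt_pos (pos_of_fin_side i))]
  have := j.2
  omega

theorem existsUnique_boardMatrix (n : ℕ) :
    ∃! μ : (Σ m : ℕ, Perm (Fin m)), IsChessboard μ.2 (boardMatrix n) := by
  have hside : ∀ _ : Fin (side n), 0 < ceilSqrt n ∧ 6 + 8 * ceilSqrt n ≤ side n := fun i =>
    ⟨ceilSqrt_pos (pos_of_fin_side i), by have := pos_of_fin_side i; unfold side; omega⟩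
  obtain ⟨m, σ, h⟩ := exists_isChessboard (boardMatrix n) boardMatrix_le_one
    (fun j => ⟨j, boardMatrix_band le_rfl (by omega)⟩)
    (fun j => ⟨j, boardMatrix_band le_rfl (by omega)⟩) (by
      intro j j' hj
      obtain ⟨hs, hN⟩ := hside j
      have hj' := j'.2
      by_cases h : (j' : ℕ) + 1 < side n
      · exact ⟨⟨j' + 1, h⟩, j', boardMatrix_band (by simp only; omega) (by simp only; omega),
          boardMatrix_band le_rfl (by omega), Fin.lt_def.2 (by simp only; omega)⟩
      -- The last column has nothing below its diagonal entry, so its higher entry comes from the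
      -- first line above the diagonal.
      · exact ⟨j', ⟨j' - ceilSqrt n, by omega⟩, boardMatrix_band (by omega) (by omega),
          boardMatrix_line 1 (by simp only; omega), Fin.lt_def.2 (by simp only; omega)⟩) (by
      intro i i' hi
      obtain ⟨hs, hN⟩ := hside i
      have hi' := i'.2
      by_cases h : (i : ℕ) = 0
      · exact ⟨⟨ceilSqrt n, by omega⟩, i, boardMatrix_line 1 (by simp only; omega),
          boardMatrix_band (by omega) (by omega), Fin.lt_def.2 (by simp only; omega)⟩
      · exact ⟨i, ⟨i - 1, by omega⟩, boardMatrix_band le_rfl (by omega),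
          boardMatrix_band (by simp only; omega) (by simp only; omega),
          Fin.lt_def.2 (by simp only; omega)⟩)
  exact ⟨⟨m, σ⟩, h, fun ν hν => IsChessboard.unique boardMatrix_le_one hν h⟩

end Board

/-! ### Embedding 321-avoiding permutations. -/

section Embedding

open Classical in
/-- The largest value of `σ`, counted from `1`, at a position in a set. -/
noncomputable def maxValue {n : ℕ} (σ : Perm (Fin n)) (P : Fin n → Prop) : ℕ :=
  (Finset.univ.filter P).sup fun q => (σ q : ℕ) + 1

variable {n : ℕ} {σ : Perm (Fin n)}

theorem le_maxValue {P : Fin n → Prop} {q : Fin n} (hq : P q) : (σ q : ℕ) + 1 ≤ maxValue σ P := by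
  classical
  exact Finset.le_sup (f := fun q => (σ q : ℕ) + 1) (Finset.mem_filter.2 ⟨Finset.mem_univ q, hq⟩)

theorem maxValue_le {P : Fin n → Prop} {b : ℕ} (h : ∀ q, P q → (σ q : ℕ) + 1 ≤ b) :
    maxValue σ P ≤ b := by
  classical
  exact Finset.sup_le fun q hq => h q (Finset.mem_filter.1 hq).2

theorem maxValue_mono {P Q : Fin n → Prop} (h : ∀ q, P q → Q q) : maxValue σ P ≤ maxValue σ Q :=
  maxValue_le fun q hq => le_maxValue (h q hq)

theorem maxValue_le_length (P : Fin n → Prop) : maxValue σ P ≤ n :=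
  maxValue_le fun q _ => (σ q).2

/-- The element at position `p` is not a left-to-right maximum. -/
def IsLower (σ : Perm (Fin n)) (p : Fin n) : Prop := ∃ q, q < p ∧ σ p < σ q

/-- The largest value up to position `p`. -/
noncomputable def runMax (σ : Perm (Fin n)) (p : Fin n) : ℕ := maxValue σ fun q => q ≤ p

/-- The largest value up to position `p` that is not a left-to-right maximum. -/
noncomputable def lowMax (σ : Perm (Fin n)) (p : Fin n) : ℕ :=
  maxValue σ fun q => q ≤ p ∧ IsLower σ q

/-- The largest value, not a left-to-right maximum, that occurs before all left-to-right maxima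
that are at least `v`. -/
noncomputable def lowBelow (σ : Perm (Fin n)) (v : ℕ) : ℕ :=
  maxValue σ fun q => IsLower σ q ∧ runMax σ q < v

theorem lowMax_le_runMax (p : Fin n) : lowMax σ p ≤ runMax σ p :=
  maxValue_mono fun _ h => h.1

theorem lowBelow_le (v : ℕ) : lowBelow σ v ≤ v :=
  maxValue_le fun q hq => (le_maxValue (P := fun t => t ≤ q) le_rfl).trans hq.2.le

theorem isPattern_perm321 {a b c : Fin n} (hab : a < b) (hbc : b < c) (h1 : σ b < σ a)
    (h2 : σ c < σ b) : IsPattern perm321 σ := by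
  have h3 := h2.trans h1
  refine ⟨![a, b, c], ?_, ?_⟩
  · intro i j hij
    fin_cases i <;> fin_cases j <;> first | exact absurd hij (by decide) | simp [*, hab.trans hbc]
  · intro i j
    rw [perm321, Fin.revPerm_apply, Fin.revPerm_apply, Fin.rev_lt_rev]
    fin_cases i <;> fin_cases j <;> simp [h1, h2, h3, h1.le, h2.le, h3.le]

/-- A larger lower element before `p`, together with its own larger predecessor and `p`, would form
321. -/
theorem lowMax_eq (hσ : σ ∈ avoiders n perm321) {p : Fin n} (hp : IsLower σ p) :
    lowMax σ p = σ p + 1 := by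
  refine le_antisymm (maxValue_le ?_) (le_maxValue ⟨le_rfl, hp⟩)
  rintro q ⟨hq, t, ht, htq⟩
  rcases hq.eq_or_lt with rfl | hlt
  · exact le_rfl
  · by_contra hn
    exact hσ (isPattern_perm321 ht hlt htq (Fin.lt_def.2 (by omega)))

theorem lowMax_lt (hσ : σ ∈ avoiders n perm321) {p q : Fin n} (hpq : p < q) (hq : IsLower σ q) :
    lowMax σ p < lowMax σ q := by
  rw [lowMax_eq hσ hq, Nat.lt_succ_iff]
  refine maxValue_le ?_
  rintro t ⟨htp, u, hu, hut⟩
  have htq := htp.trans_lt hpq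
  by_contra hn
  have hne : σ q ≠ σ t := fun e => htq.ne' (σ.injective e)
  have : (σ q : ℕ) ≠ σ t := fun e => hne (Fin.ext e)
  exact hσ (isPattern_perm321 hu htq hut (Fin.lt_def.2 (by omega)))

theorem lt_of_not_isLower {p q : Fin n} (hp : ¬ IsLower σ p) (hqp : q < p) : σ q < σ p := by
  by_contra hn
  exact hp ⟨q, hqp, (not_lt.1 hn).lt_of_ne fun e => hqp.ne' (σ.injective e)⟩

theorem runMax_eq {p : Fin n} (hp : ¬ IsLower σ p) : runMax σ p = σ p + 1 := by
  refine le_antisymm (maxValue_le fun q hq => ?_) (le_maxValue (P := fun q => q ≤ p) le_rfl)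
  rcases hq.eq_or_lt with rfl | hlt
  · exact le_rfl
  · have := Fin.lt_def.1 (lt_of_not_isLower hp hlt)
    omega

/-- For a left-to-right maximum `p`, the running maximum is below the value at `p` exactly before
`p`. This links the row's data, indexed by value, to the column's, indexed by position. -/
theorem lowBelow_eq {p : Fin n} (hp : ¬ IsLower σ p) : lowBelow σ (σ p + 1) = lowMax σ p := by
  refine le_antisymm (maxValue_mono ?_) (maxValue_mono ?_)
  · rintro q ⟨hq, hlt⟩
    refine ⟨?_, hq⟩
    by_contra hn
    have := le_maxValue (σ := σ) (P := fun t => t ≤ q) (not_le.1 hn).le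
    exact absurd hlt (not_lt.2 this)
  · rintro q ⟨hqp, hq⟩
    refine ⟨hq, Nat.lt_succ_iff.2 (maxValue_le fun t ht => ?_)⟩
    have hlt : q < p := lt_of_le_of_ne hqp fun e => hp (e ▸ hq)
    exact Fin.lt_def.1 (lt_of_not_isLower hp (ht.trans_lt hlt))

/-- The row used for the value `v`. -/
noncomputable def cellRow (σ : Perm (Fin n)) (s v : ℕ) : ℕ :=
  (2 * (v / s + lowBelow σ v / s) + if v / s = lowBelow σ v / s then 0 else 1) * s + v % s

/-- The column used for the position `p`. -/
noncomputable def cellCol (σ : Perm (Fin n)) (s : ℕ) (p : Fin n) : ℕ :=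
  2 * (runMax σ p / s + lowMax σ p / s) * s + lowMax σ p % s

theorem div_mod_lt {s a b x y : ℕ} (hs : 0 < s) (h : x < y) : x * s + a % s < y * s + b % s := by
  have h1 := Nat.mod_lt a hs
  have h2 : (x + 1) * s ≤ y * s := Nat.mul_le_mul_right s h
  rw [add_mul] at h2
  omega

theorem mod_lt_mod_of_div_eq {s a b : ℕ} (h : a < b) (hd : a / s = b / s) : a % s < b % s := by
  have h1 := Nat.div_add_mod a s
  have h2 := Nat.div_add_mod b s
  rw [hd] at h1
  omega

/-- Both quotients are weakly increasing. If their sum grows, the factor 2 outweighs the 0/1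
correction; if not, both are unchanged and the residue of the value grows. -/
theorem cellRow_lt {s v w : ℕ} (hs : 0 < s) (h : v < w) : cellRow σ s v < cellRow σ s w := by
  have h1 : v / s ≤ w / s := Nat.div_le_div_right h.le
  have h2 : lowBelow σ v / s ≤ lowBelow σ w / s :=
    Nat.div_le_div_right (maxValue_mono fun q hq => ⟨hq.1, hq.2.trans h⟩)
  unfold cellRow
  rcases (add_le_add h1 h2).lt_or_eq with h3 | h3
  · apply div_mod_lt hs
    split_ifs <;> omega
  · have h4 : v / s = w / s := by omega
    have h5 : lowBelow σ v / s = lowBelow σ w / s := by omega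
    rw [h4, h5]
    exact Nat.add_lt_add_left (mod_lt_mod_of_div_eq h h4) _

/-- A tie means that `lowMax` did not change, which for a 321-avoider forces the later element to be
a left-to-right maximum (`lowMax_lt`), hence in a higher row. -/
theorem cellCol_lt_or {s : ℕ} {p q : Fin n} (hs : 0 < s) (h : p < q) :
    cellCol σ s p < cellCol σ s q ∨
      cellCol σ s p = cellCol σ s q ∧ lowMax σ p = lowMax σ q := by
  have h1 : runMax σ p / s ≤ runMax σ q / s :=
    Nat.div_le_div_right (maxValue_mono fun t ht => ht.trans h.le)
  have h0 : lowMax σ p ≤ lowMax σ q := maxValue_mono fun t ht => ⟨ht.1.trans h.le, ht.2⟩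
  have h2 : lowMax σ p / s ≤ lowMax σ q / s := Nat.div_le_div_right h0
  unfold cellCol
  rcases (add_le_add h1 h2).lt_or_eq with h3 | h3
  · left
    apply div_mod_lt hs
    omega
  · have h4 : runMax σ p / s = runMax σ q / s := by omega
    have h5 : lowMax σ p / s = lowMax σ q / s := by omega
    rw [h4, h5]
    rcases h0.lt_or_eq with h6 | h6
    · exact Or.inl (Nat.add_lt_add_left (mod_lt_mod_of_div_eq h6 h5) _)
    · exact Or.inr ⟨by rw [h6], h6⟩

theorem cellRow_lt_bound {s v : ℕ} (hs : 0 < s) (hv : v ≤ n) :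
    cellRow σ s v < 4 * n + 2 * s := by
  have h1 : v / s ≤ n / s := Nat.div_le_div_right hv
  have h2 : lowBelow σ v / s ≤ n / s := Nat.div_le_div_right (maxValue_le_length _)
  have h3 := Nat.mod_lt v hs
  have h4 := Nat.div_mul_le_self n s
  have h5 : (2 * (v / s + lowBelow σ v / s) +
      if v / s = lowBelow σ v / s then 0 else 1) * s ≤ (4 * (n / s) + 1) * s := by
    apply Nat.mul_le_mul_right
    split_ifs <;> omega
  have h6 : (4 * (n / s) + 1) * s = 4 * (n / s * s) + s := by ring
  unfold cellRow
  omega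

theorem cellCol_lt_bound {s : ℕ} (hs : 0 < s) (p : Fin n) :
    cellCol σ s p < 4 * n + 2 * s := by
  have h1 : runMax σ p / s ≤ n / s := Nat.div_le_div_right (maxValue_le_length _)
  have h2 : lowMax σ p / s ≤ n / s := Nat.div_le_div_right (maxValue_le_length _)
  have h3 := Nat.mod_lt (lowMax σ p) hs
  have h4 := Nat.div_mul_le_self n s
  have h5 : 2 * (runMax σ p / s + lowMax σ p / s) * s ≤ 4 * (n / s) * s := by
    apply Nat.mul_le_mul_right
    omega
  have h6 : 4 * (n / s) * s = 4 * (n / s * s) := by ring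
  unfold cellCol
  omega

/-- The difference is `A mod s - B mod s`, plus `s` when the quotients differ. With equal quotients,
`B ≤ A` keeps it nonnegative; otherwise the extra `s` does. -/
theorem cell_band {s : ℕ} (hs : 0 < s) {p : Fin n} (hp : ¬ IsLower σ p) :
    cellCol σ s p ≤ cellRow σ s (σ p + 1) ∧
      cellRow σ s (σ p + 1) ≤ cellCol σ s p + (2 * s + 1) := by
  have hle := lowMax_le_runMax (σ := σ) p
  unfold cellRow cellCol
  rw [lowBelow_eq hp, ← runMax_eq hp]
  have h1 := Nat.mod_lt (lowMax σ p) hs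
  have h2 := Nat.mod_lt (runMax σ p) hs
  split_ifs with h
  · have : lowMax σ p % s ≤ runMax σ p % s := by
      rcases hle.lt_or_eq with h3 | h3
      · exact (mod_lt_mod_of_div_eq h3 h.symm).le
      · rw [h3]
    rw [add_zero]
    omega
  · rw [add_mul]
    omega

/-- The residues cancel. Since `L ≤ v ≤ A`, the number of blocks `2(⌊A/s⌋-⌊L/s⌋) - ε` is
nonnegative: `ε = 1` forces `⌊L/s⌋ < ⌊v/s⌋ ≤ ⌊A/s⌋`. -/
theorem cell_line (hσ : σ ∈ avoiders n perm321) {s : ℕ} {p : Fin n}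
    (hp : IsLower σ p) : ∃ k, cellCol σ s p = cellRow σ s (σ p + 1) + k * s := by
  have hA : σ p + 1 ≤ runMax σ p := le_maxValue (P := fun q => q ≤ p) le_rfl
  have h1 := lowBelow_le (σ := σ) (σ p + 1)
  unfold cellRow cellCol
  rw [lowMax_eq hσ hp]
  set v := (σ p : ℕ) + 1
  have h2 : v / s ≤ runMax σ p / s := Nat.div_le_div_right hA
  have h3 : lowBelow σ v / s ≤ v / s := Nat.div_le_div_right h1
  obtain ⟨k, hk⟩ : ∃ k, 2 * (runMax σ p / s + v / s) =
      (2 * (v / s + lowBelow σ v / s) + if v / s = lowBelow σ v / s then 0 else 1) + k := by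
    apply Nat.exists_eq_add_of_le
    split_ifs <;> omega
  refine ⟨k, ?_⟩
  rw [hk]
  ring

theorem isSuperpattern_of_isChessboard {m : ℕ} {μ : Perm (Fin m)}
    (hμ : IsChessboard μ (boardMatrix n)) : IsSuperpattern μ (avoiders n perm321) := by
  intro σ hσ
  rcases Nat.eq_zero_or_pos n with rfl | hn
  · exact ⟨fun p => p.elim0, fun p => p.elim0, fun p => p.elim0⟩
  have hs := ceilSqrt_pos hn
  have hN : 4 * n + 2 * ceilSqrt n ≤ side n := by
    unfold side
    omega
  refine hμ.isPattern (fun p => ⟨cellRow σ (ceilSqrt n) (σ p + 1), ?_⟩)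
    (fun p => ⟨cellCol σ (ceilSqrt n) p, ?_⟩) (fun p => ?_) (fun p q hpq => ?_)
    (fun p q hpq => Or.inl ?_)
  · exact (cellRow_lt_bound hs (σ p).2).trans_le hN
  · exact (cellCol_lt_bound hs p).trans_le hN
  · apply ne_of_eq_of_ne _ one_ne_zero
    by_cases hp : IsLower σ p
    · obtain ⟨k, hk⟩ := cell_line hσ (s := ceilSqrt n) hp
      exact boardMatrix_line k hk
    · exact boardMatrix_band (cell_band hs hp).1 (cell_band hs hp).2
  · rcases cellCol_lt_or (σ := σ) hs hpq with h | ⟨h1, h2⟩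
    · exact Or.inl h
    · refine Or.inr ⟨Fin.ext h1, cellRow_lt hs (Nat.succ_lt_succ (Fin.lt_def.1 ?_))⟩
      exact lt_of_not_isLower (fun hq => (lowMax_lt hσ hpq hq).ne h2) hpq
  · exact cellRow_lt hs (Nat.succ_lt_succ (Fin.lt_def.1 hpq))

/-- Inversion swaps positions and values, so the values of the occurrence become its positions. -/
theorem IsPattern.inv {k m : ℕ} {π : Perm (Fin k)} {μ : Perm (Fin m)} (h : IsPattern π μ) :
    IsPattern π⁻¹ μ⁻¹ := by
  obtain ⟨l, hl, h⟩ := h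
  refine ⟨fun i => μ (l (π⁻¹ i)), fun i j hij => (h _ _).1 (by simpa using hij), fun i j => ?_⟩
  simp only [perm_inv_apply_self]
  exact hl.lt_iff_lt.symm

theorem perm321_inv : perm321⁻¹ = perm321 := rfl

theorem inv_mem_avoiders (hσ : σ ∈ avoiders n perm321) : σ⁻¹ ∈ avoiders n perm321 := by
  intro h
  have := h.inv
  rw [perm321_inv, inv_inv] at this
  exact hσ this

theorem IsSuperpattern.inv {m : ℕ} {μ : Perm (Fin m)}
    (h : IsSuperpattern μ (avoiders n perm321)) : IsSuperpattern μ⁻¹ (avoiders n perm321) := by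
  intro σ hσ
  have := (h _ (inv_mem_avoiders hσ)).inv
  rwa [inv_inv] at this

end Embedding

/-! ### Counting the ones. -/

section Length

theorem sum_boardMatrix_row {n : ℕ} (i : Fin (side n)) :
    ∑ j, boardMatrix n i j =
      (min (i : ℕ) (2 * ceilSqrt n + 1) + 1) + (side n - 1 - i) / ceilSqrt n := by
  classical
  have hs := ceilSqrt_pos (pos_of_fin_side i)
  have hi := i.2
  set s := ceilSqrt n with hs_def
  set B := Finset.Icc ((i : ℕ) - (2 * s + 1)) i
  -- The line `k = 0` is the diagonal, already counted in the band.
  set D := (Finset.Icc 1 ((side n - 1 - i) / s)).image fun k => (i : ℕ) + k * s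
  have hB : B.card = min (i : ℕ) (2 * s + 1) + 1 := by
    rw [Nat.card_Icc]
    omega
  have hD : D.card = (side n - 1 - i) / s := by
    rw [Finset.card_image_of_injective, Nat.card_Icc, Nat.add_sub_cancel]
    intro a b hab
    exact Nat.eq_of_mul_eq_mul_right hs (Nat.add_left_cancel hab)
  have hdisj : Disjoint B D := by
    rw [Finset.disjoint_left]
    intro x hx hx'
    obtain ⟨k, hk, rfl⟩ := Finset.mem_image.1 hx'
    have h1 := (Finset.mem_Icc.1 hx).2
    have h2 := Nat.mul_pos (Finset.mem_Icc.1 hk).1 hs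
    omega
  rw [← hB, ← hD, ← Finset.card_union_of_disjoint hdisj]
  have hsum : ∑ j, boardMatrix n i j =
      (Finset.univ.filter fun j => boardMatrix n i j = 1).card := by
    rw [Finset.card_filter]
    refine Finset.sum_congr rfl fun j _ => ?_
    have := boardMatrix_le_one i j
    split_ifs <;> omega
  rw [hsum, ← Finset.card_map Fin.valEmbedding]
  congr 1
  ext x
  simp only [Finset.mem_map, Finset.mem_filter, Finset.mem_univ, true_and, Fin.valEmbedding_apply,
    Finset.mem_union]
  constructor
  · rintro ⟨j, hj, rfl⟩
    have hj2 := j.2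
    have hcase : (0 ≤ ((i : ℕ) : ℤ) - ((j : ℕ) : ℤ) ∧
        ((i : ℕ) : ℤ) - ((j : ℕ) : ℤ) ≤ 2 * (ceilSqrt n : ℤ) + 1) ∨
        (∃ k : ℕ, k ≤ side n / ceilSqrt n ∧
          ((j : ℕ) : ℤ) - ((i : ℕ) : ℤ) = (k : ℤ) * (ceilSqrt n : ℤ)) := by
      by_contra hn
      rw [boardMatrix, if_neg hn] at hj
      exact zero_ne_one hj
    rcases hcase with ⟨h1, h2⟩ | ⟨k, -, hk⟩
    · left
      exact Finset.mem_Icc.2 ⟨by omega, by omega⟩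
    · have hk' : (j : ℕ) = i + k * s := by
        zify
        linarith
      rcases Nat.eq_zero_or_pos k with rfl | hk0
      · left
        exact Finset.mem_Icc.2 ⟨by omega, by omega⟩
      · right
        refine Finset.mem_image.2 ⟨k, Finset.mem_Icc.2 ⟨hk0, ?_⟩, hk'.symm⟩
        rw [Nat.le_div_iff_mul_le hs]
        omega
  · rintro (hx | hx)
    · obtain ⟨h1, h2⟩ := Finset.mem_Icc.1 hx
      exact ⟨⟨x, by omega⟩, boardMatrix_band h2 (by simp only; omega), rfl⟩
    · obtain ⟨k, hk, rfl⟩ := Finset.mem_image.1 hx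
      have h1 := (Finset.mem_Icc.1 hk).2
      rw [Nat.le_div_iff_mul_le hs] at h1
      exact ⟨⟨i + k * s, by omega⟩, boardMatrix_line k rfl, rfl⟩

theorem sum_range_sub_div (N : ℕ) (s : ℝ) :
    ∑ i ∈ Finset.range N, ((N : ℝ) - 1 - i) / s = N * (N - 1) / 2 / s := by
  rw [← Finset.sum_div]
  congr 1
  have h : ∀ k : ℕ, ∑ i ∈ Finset.range k, (i : ℝ) = k * (k - 1) / 2 := by
    intro k
    induction k with
    | zero => simp
    | succ k ih =>
      rw [Finset.sum_range_succ, ih]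
      push_cast
      ring
  rw [Finset.sum_sub_distrib, h]
  simp
  ring

theorem length_bounds {n m : ℕ} (hn : 0 < n) {μ : Perm (Fin m)}
    (hμ : IsChessboard μ (boardMatrix n)) :
    (side n : ℝ) * (2 * ceilSqrt n + 2) - (2 * ceilSqrt n + 2) ^ 2 +
        side n * (side n - 1) / 2 / ceilSqrt n - side n ≤ m ∧
      (m : ℝ) ≤ side n * (2 * ceilSqrt n + 2) + side n * (side n - 1) / 2 / ceilSqrt n := by
  have hs := ceilSqrt_pos hn
  have hs' : (0 : ℝ) < ceilSqrt n := Nat.cast_pos.2 hs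
  have hlen := hμ.length_eq
  simp only [sum_boardMatrix_row] at hlen
  rw [Fin.sum_univ_eq_sum_range (fun i => min i (2 * ceilSqrt n + 1) + 1 +
    (side n - 1 - i) / ceilSqrt n)] at hlen
  have hlen' : (m : ℝ) = ∑ i ∈ Finset.range (side n), (((min i (2 * ceilSqrt n + 1) + 1 : ℕ) : ℝ) +
      (((side n - 1 - i) / ceilSqrt n : ℕ) : ℝ)) := by
    rw [hlen]
    push_cast
    rfl
  rw [Finset.sum_add_distrib] at hlen'
  have hN : 2 * ceilSqrt n + 2 ≤ side n := by
    unfold side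
    omega
  have hdiv : ∀ i ∈ Finset.range (side n),
      ((side n : ℝ) - 1 - i) / ceilSqrt n - 1 ≤ (((side n - 1 - i) / ceilSqrt n : ℕ) : ℝ) ∧
      (((side n - 1 - i) / ceilSqrt n : ℕ) : ℝ) ≤ ((side n : ℝ) - 1 - i) / ceilSqrt n := by
    intro i hi
    have hi' := Finset.mem_range.1 hi
    have hcast : ((side n - 1 - i : ℕ) : ℝ) = (side n : ℝ) - 1 - i := by
      rw [Nat.sub_sub, Nat.cast_sub (by omega)]
      push_cast
      ring
    rw [← hcast]
    refine ⟨?_, Nat.cast_div_le⟩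
    rw [sub_le_iff_le_add, div_le_iff₀ hs']
    have h1 := Nat.lt_div_mul_add (a := side n - 1 - i) hs
    have h2 : ((side n - 1 - i : ℕ) : ℝ) <
        (((side n - 1 - i) / ceilSqrt n : ℕ) : ℝ) * ceilSqrt n + ceilSqrt n := by
      exact_mod_cast h1
    linarith
  have hband : ∑ i ∈ Finset.range (side n), ((min i (2 * ceilSqrt n + 1) + 1 : ℕ) : ℝ) ≤
      side n * (2 * ceilSqrt n + 2) := by
    refine (Finset.sum_le_card_nsmul _ _ (2 * (ceilSqrt n : ℝ) + 2) fun i _ => ?_).trans ?_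
    · have : min i (2 * ceilSqrt n + 1) + 1 ≤ 2 * ceilSqrt n + 2 := by omega
      exact_mod_cast this
    · simp [mul_add]
  have hband' : (side n : ℝ) * (2 * ceilSqrt n + 2) - (2 * ceilSqrt n + 2) ^ 2 ≤
      ∑ i ∈ Finset.range (side n), ((min i (2 * ceilSqrt n + 1) + 1 : ℕ) : ℝ) := by
    -- Rows from `2s + 2` on contain the full band width; the earlier ones are discarded at a cost
    -- of `O(s²)`.
    have h1 : ∑ i ∈ Finset.Ico (2 * ceilSqrt n + 2) (side n), (2 * (ceilSqrt n : ℝ) + 2) ≤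
        ∑ i ∈ Finset.range (side n), ((min i (2 * ceilSqrt n + 1) + 1 : ℕ) : ℝ) := by
      refine (Finset.sum_le_sum fun i hi => ?_).trans (Finset.sum_le_sum_of_subset_of_nonneg
        (fun i hi => Finset.mem_range.2 (Finset.mem_Ico.1 hi).2) fun i _ _ => Nat.cast_nonneg _)
      have : 2 * ceilSqrt n + 2 ≤ min i (2 * ceilSqrt n + 1) + 1 := by
        have := (Finset.mem_Ico.1 hi).1
        omega
      exact_mod_cast this
    rw [Finset.sum_const, Nat.card_Ico, nsmul_eq_mul, Nat.cast_sub hN] at h1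
    push_cast at h1
    push_cast
    linarith
  have hline := Finset.sum_le_sum fun i hi => (hdiv i hi).2
  have hline' := Finset.sum_le_sum fun i hi => (hdiv i hi).1
  rw [sum_range_sub_div] at hline
  rw [Finset.sum_sub_distrib, sum_range_sub_div] at hline'
  simp only [Finset.sum_const, Finset.card_range, nsmul_eq_mul, mul_one] at hline'
  constructor <;> linarith

theorem length_asymptotics {n m : ℕ} (hn : 1 ≤ n) {μ : Perm (Fin m)}
    (hμ : IsChessboard μ (boardMatrix n)) :
    1 * (n : ℝ) ≤ (m : ℝ) - 30 * (n : ℝ) ^ (3 / 2 : ℝ) ∧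
      (m : ℝ) - 30 * (n : ℝ) ^ (3 / 2 : ℝ) ≤ 300 * (n : ℝ) := by
  obtain ⟨hlow, hup⟩ := length_bounds hn hμ
  have hn' : (1 : ℝ) ≤ n := by exact_mod_cast hn
  set r := Real.sqrt n with hr
  have hr1 : 1 ≤ r := Real.one_le_sqrt.2 hn'
  have hrr : (n : ℝ) = r ^ 2 := (Real.sq_sqrt (by linarith)).symm
  have hpow : (n : ℝ) ^ (3 / 2 : ℝ) = r ^ 3 := by
    rw [hr, Real.sqrt_eq_rpow, ← Real.rpow_natCast, ← Real.rpow_mul (by linarith)]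
    norm_num
  have hsr : r ≤ ceilSqrt n := Nat.le_ceil _
  have hsr' : (ceilSqrt n : ℝ) < r + 1 := Nat.ceil_lt_add_one (by linarith)
  have hside : (side n : ℝ) = 6 * r ^ 2 + 8 * ceilSqrt n := by
    rw [← hrr]
    simp [side]
  rw [hpow, hrr]
  rw [hside] at hlow hup
  generalize (ceilSqrt n : ℝ) = s at *
  have hs : 0 < s := by linarith
  have hexp : (6 * r ^ 2 + 8 * s) * (6 * r ^ 2 + 8 * s - 1) / 2 / s =
      18 * (r ^ 4 / s) + 48 * r ^ 2 + 32 * s - 3 * (r ^ 2 / s) - 4 := by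
    field_simp
    ring
  rw [hexp] at hlow hup
  have h1 : r ^ 4 / s ≤ r ^ 3 := by
    rw [div_le_iff₀ hs]
    nlinarith [pow_pos (by linarith : 0 < r) 3]
  have h2 : r ^ 2 / s ≤ r := by
    rw [div_le_iff₀ hs]
    nlinarith
  have h3 : 0 ≤ r ^ 2 / s := by positivity
  -- Tangent-line bound for `1/s` at `s = r`, equivalent to `(r - s)² ≥ 0`; it makes the rounding
  -- error in `s` cost only `O(r²)`.
  have h4 : r ^ 2 * (2 * r - s) ≤ r ^ 4 / s := by
    rw [le_div_iff₀ hs]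
    nlinarith [mul_nonneg (sq_nonneg r) (sq_nonneg (r - s))]
  have h5 : r ≤ r ^ 2 := by nlinarith
  have h6 : r ^ 2 * s ≤ r ^ 2 * (r + 1) := by gcongr
  have h7 : s ^ 2 ≤ (r + 1) ^ 2 := by gcongr
  have h8 : r ^ 2 ≤ s ^ 2 := by gcongr
  constructor
  · nlinarith
  · nlinarith

end Length

end Superpattern

theorem theorem3p4 :
    -- the matrix `M_n` is the chessboard representation of exactly one permutation `μ_n`
    (∀ n : ℕ, ∃! μ : (Σ m : ℕ, Equiv.Perm (Fin m)),
      Superpattern.IsChessboard μ.2 (Superpattern.boardMatrix n)) ∧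
    -- `μ_n` is an `S_n(321)`-superpattern, and so is its inverse (rows and columns exchanged)
    (∀ (n m : ℕ) (μ : Equiv.Perm (Fin m)),
      Superpattern.IsChessboard μ (Superpattern.boardMatrix n) →
        Superpattern.IsSuperpattern μ (Superpattern.avoiders n Superpattern.perm321) ∧
        Superpattern.IsSuperpattern μ⁻¹ (Superpattern.avoiders n Superpattern.perm321)) ∧
    -- the length of `μ_n` is `30 n ^ (3/2) + Θ(n)`
    (∃ c C : ℝ, 0 < c ∧ 0 < C ∧ ∃ n₀ : ℕ, ∀ n : ℕ, n₀ ≤ n →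
      ∀ (m : ℕ) (μ : Equiv.Perm (Fin m)),
        Superpattern.IsChessboard μ (Superpattern.boardMatrix n) →
          c * (n : ℝ) ≤ (m : ℝ) - 30 * (n : ℝ) ^ (3 / 2 : ℝ) ∧
          (m : ℝ) - 30 * (n : ℝ) ^ (3 / 2 : ℝ) ≤ C * (n : ℝ)) := by
  refine ⟨Superpattern.existsUnique_boardMatrix, fun n m μ hμ => ?_, 1, 300, one_pos, by norm_num,
    1, fun n hn m μ hμ => Superpattern.length_asymptotics hn hμ⟩
  have h := Superpattern.isSuperpattern_of_isChessboard hμ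
  exact ⟨h, h.inv⟩
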